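/- Graphs are finite, connected and simple, and $\mathsf{vcn}(G)$ is the minimum size of a vertex cover of $G$. In each game below, first $k$ cops are placed on vertices of $G$ (several cops may share a vertex), then the robber is placed on a vertex; afterwards the cop player and the robber player move alternately, cops first, with full information. The cops win if they can force, within finitely many moves, the winning position of the game, whatever the robber does. * Fully Active CnR: in every turn each cop, respectively the robber, must move to an adjacent vertex. The cops win when a cop is on the robber's vertex. * Cops and Fast Robber, for a fixed speed $s \ge 1$: in a turn each cop stays or moves to an adjacent vertex; the robber moves along a path with at most $s$ edges that contains no cop. The cops win when a cop is on the robber's vertex. * Surrounding CnR: in a turn each cop stays or moves to an adjacent vertex, and so does the robber; a cop may move onto the robber's vertex, but the robber may not end a turn (or be placed) on a vertex occupied by a cop. The cops win when every neighbour of the robber's vertex is occupied by a cop. For each of these games, consider the decision problem: given $G$ and $k \in \mathbb{N}$, do $k$ cops have a winning strategy on $G$? An instance of the problem parameterized by the vertex cover number is $((G,k),t)$ with parameter $t \ge 1$, where $\mathsf{vcn}(G) \le t$ (in particular, $t = \mathsf{vcn}(G)$ is allowed if $G$ has an edge). Theorem. Each of the three problems Fully Active CnR, Cops and Fast Robber (for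 every $s \ge 1$) and Surrounding CnR, parameterized by the vertex cover number, admits a kernel with at most $t + t\cdot 2^{t}$ vertices, that is, with at most $\mathsf{vcn} + \mathsf{vcn}\cdot 2^{\mathsf{vcn}}$ vertices when $t = \mathsf{vcn}(G)$. Precisely: there are a polynomial-time algorithm and a computable function $g$ such that the algorithm maps every instance $((G,k),t)$ to an instance $((G',k'),t')$ of the same problem for which $k$ cops have a winning strategy on $G$ if and only if $k'$ cops have a winning strategy on $G'$, $|V(G')| \le t + t\cdot 2^{t}$, and the encoding of $((G',k'),t')$ has at most $g(t)$ bits. -/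

import Mathlib

namespace CopsKernel

/-! ### The pursuit games -/

/-- A two-player pursuit game with `k` cops and one robber on the vertex set `V`: where the robber
may be placed, how the cops and the robber may move, and in which positions the cops have won.
A position is a placement `c : Fin k → V` of the cops (several cops may share a vertex) together
with the vertex `r : V` of the robber. -/
structure Game (V : Type) (k : ℕ) where
  /-- legal initial placements of the robber, once the cops are placed -/
  start : (Fin k → V) → V → Prop
  /-- legal moves of the cops -/
  copMove : (Fin k → V) → (Fin k → V) → Prop
  /-- legal moves of the robber, for the current placement of the cops -/
  robberMove : (Fin k → V) → V → V → Prop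
  /-- the positions that end the game in favour of the cops -/
  won : (Fin k → V) → V → Prop

/-- `X.Forced c r`: the cops, who are to move in the position `(c, r)`, have a strategy that
reaches a won position whatever the robber does. A derivation is a strategy tree without infinite
branches: one move for the cops, then one branch for every legal answer of the robber. A robber
without a legal move is not beaten for that reason. -/
inductive Game.Forced {V : Type} {k : ℕ} (X : Game V k) : (Fin k → V) → V → Prop
  | already {c : Fin k → V} {r : V} (h : X.won c r) : Game.Forced X c r
  | finish {c : Fin k → V} {r : V} (c' : Fin k → V) (hc : X.copMove c c') (h : X.won c' r) :
      Game.Forced X c r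
  | step {c : Fin k → V} {r : V} (c' : Fin k → V) (hc : X.copMove c c')
      (hr : ∃ r', X.robberMove c' r r')
      (h : ∀ r', X.robberMove c' r r' → Game.Forced X c' r') : Game.Forced X c r

/-- The cops have a winning strategy: they can place themselves so that, wherever the robber is
then legally placed, they can force a won position, moving first. -/
def Game.CopsWin {V : Type} {k : ℕ} (X : Game V k) : Prop :=
  ∃ c : Fin k → V, ∀ r : V, X.start c r → X.Forced c r

/-- Fully Active Cops and Robber: in each turn every agent has to move to an adjacent vertex. The
cops win when one of them is on the vertex of the robber. -/
def fullyActive {V : Type} (G : SimpleGraph V) (k : ℕ) : Game V k where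
  start _ _ := True
  copMove c c' := ∀ i, G.Adj (c i) (c' i)
  robberMove _ r r' := G.Adj r r'
  won c r := ∃ i, c i = r

/-- Cops and Fast Robber, with a robber of speed `s`: each cop stays or moves to an adjacent
vertex; the robber moves along a path with at most `s` edges that contains no cop. The cops win when
one of them is on the vertex of the robber. -/
def fastRobber (s : ℕ) {V : Type} (G : SimpleGraph V) (k : ℕ) : Game V k where
  start _ _ := True
  copMove c c' := ∀ i, c' i = c i ∨ G.Adj (c i) (c' i)
  robberMove c r r' := ∃ p : G.Walk r r', p.IsPath ∧ p.length ≤ s ∧ ∀ v ∈ p.support, ∀ i, c i ≠ v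
  won c r := ∃ i, c i = r

/-- Surrounding Cops and Robber: each agent stays or moves to an adjacent vertex; a cop may step on
the vertex of the robber, but the robber may not end a turn (the placement included) on a vertex
that is occupied by a cop. The cops win when every neighbour of the vertex of the robber is
occupied by a cop. -/
def surrounding {V : Type} (G : SimpleGraph V) (k : ℕ) : Game V k where
  start c r := ∀ i, c i ≠ r
  copMove c c' := ∀ i, c' i = c i ∨ G.Adj (c i) (c' i)
  robberMove c r r' := (r' = r ∨ G.Adj r r') ∧ ∀ i, c i ≠ r'
  won c r := ∀ u, G.Adj r u → ∃ i, c i = u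

/-! ### The machine model: a random access machine

Programs are structured programs for a random access machine with natural numbers as words,
registers, and finitely many named memory arrays. Arithmetic is restricted to addition and truncated
subtraction, and every elementary operation costs one time unit; without multiplication the length
of a word grows by at most one bit per operation, so that this machine and Turing machines simulate
each other with polynomial overhead. -/

/-- The contents of the registers and of the memory arrays. -/
structure State where
  reg : ℕ → ℕ
  mem : ℕ → ℕ → ℕ

/-- Expressions: constants, registers, sums, truncated differences, and `load a e`, the cell of the
array `a` at the address `e`. -/
inductive Expr
  | const (m : ℕ)
  | reg (x : ℕ)
  | add (e f : Expr)
  | sub (e f : Expr)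
  | load (a : ℕ) (e : Expr)

/-- The value of an expression. -/
def Expr.eval (σ : State) : Expr → ℕ
  | .const m => m
  | .reg x => σ.reg x
  | .add e f => e.eval σ + f.eval σ
  | .sub e f => e.eval σ - f.eval σ
  | .load a e => σ.mem a (e.eval σ)

/-- The number of elementary operations in the evaluation of an expression. -/
def Expr.cost : Expr → ℕ
  | .const _ => 1
  | .reg _ => 1
  | .add e f => e.cost + f.cost + 1
  | .sub e f => e.cost + f.cost + 1
  | .load _ e => e.cost + 1

/-- Programs. A condition is true when its value is not `0`. -/
inductive Prog
  | skip
  | assign (x : ℕ) (e : Expr)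
  | store (a : ℕ) (i e : Expr)
  | seq (p q : Prog)
  | ite (e : Expr) (p q : Prog)
  | loop (e : Expr) (p : Prog)

/-- Write `v` into the register `x`. -/
def State.setReg (σ : State) (x v : ℕ) : State :=
  { σ with reg := Function.update σ.reg x v }

/-- Write `v` into the cell `i` of the array `a`. -/
def State.setMem (σ : State) (a i v : ℕ) : State :=
  { σ with mem := Function.update σ.mem a (Function.update (σ.mem a) i v) }

/-- `Exec p σ T τ`: the program `p`, started in the state `σ`, halts after exactly `T` time units
in the state `τ`. -/
inductive Exec : Prog → State → ℕ → State → Prop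
  | skip (σ : State) : Exec .skip σ 1 σ
  | assign (σ : State) (x : ℕ) (e : Expr) :
      Exec (.assign x e) σ (e.cost + 1) (σ.setReg x (e.eval σ))
  | store (σ : State) (a : ℕ) (i e : Expr) :
      Exec (.store a i e) σ (i.cost + e.cost + 1) (σ.setMem a (i.eval σ) (e.eval σ))
  | seq {p q : Prog} {σ τ υ : State} {T U : ℕ} (hp : Exec p σ T τ) (hq : Exec q τ U υ) :
      Exec (.seq p q) σ (T + U) υ
  | iteTrue {e : Expr} {p q : Prog} {σ τ : State} {T : ℕ} (he : e.eval σ ≠ 0)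
      (hp : Exec p σ T τ) : Exec (.ite e p q) σ (e.cost + 1 + T) τ
  | iteFalse {e : Expr} {p q : Prog} {σ τ : State} {T : ℕ} (he : e.eval σ = 0)
      (hq : Exec q σ T τ) : Exec (.ite e p q) σ (e.cost + 1 + T) τ
  | loopTrue {e : Expr} {p : Prog} {σ τ υ : State} {T U : ℕ} (he : e.eval σ ≠ 0)
      (hp : Exec p σ T τ) (hl : Exec (.loop e p) τ U υ) :
      Exec (.loop e p) σ (e.cost + 1 + T + U) υ
  | loopFalse {e : Expr} {p : Prog} {σ : State} (he : e.eval σ = 0) :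
      Exec (.loop e p) σ (e.cost + 1) σ

/-- The initial state on the input word list `w`: register `0` holds the length of `w`, array `0`
holds `w`, everything else is `0`. -/
def inputState (w : List ℕ) : State where
  reg x := if x = 0 then w.length else 0
  mem a i := if a = 0 then w.getD i 0 else 0

/-- The state `τ` shows the output word list `w`: register `0` holds the length of `w`, and array
`1` starts with `w`. -/
def ShowsOutput (τ : State) (w : List ℕ) : Prop :=
  τ.reg 0 = w.length ∧ ∀ i < w.length, τ.mem 1 i = w.getD i 0

/-- On the input `w` the program `P` halts within `T` time units with the output `w'`. -/
def Prog.OutputsWithin (P : Prog) (w w' : List ℕ) (T : ℕ) : Prop :=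
  ∃ U τ, U ≤ T ∧ Exec P (inputState w) U τ ∧ ShowsOutput τ w'

/-- The size of a list of words: the total number of bits, with one separator for each word. -/
def bitSize (w : List ℕ) : ℕ := (w.map fun m => m.size + 1).sum

/-! ### Problems parameterized by the vertex cover number, and kernels -/

/-- An instance `((G, k), t)`: a finite graph `G`, a number `k` of cops, and the parameter `t`. -/
structure Inst where
  n : ℕ
  G : SimpleGraph (Fin n)
  k : ℕ
  t : ℕ

/-- The instances of the parameterized problems: `G` is connected, and the parameter `t ≥ 1` is
(an upper bound on) the vertex cover number of `G`. -/
structure Inst.Valid (I : Inst) : Prop where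
  connected : I.G.Connected
  cover : I.G.vertexCoverNum ≤ (I.t : ℕ∞)
  pos : 1 ≤ I.t

open Classical in
/-- The encoding of an instance: `n`, `k`, `t`, and the adjacency matrix row by row. -/
noncomputable def Inst.encode (I : Inst) : List ℕ :=
  I.n :: I.k :: I.t ::
    List.ofFn fun e : Fin (I.n * I.n) => if I.G.Adj e.divNat e.modNat then 1 else 0

/-- A decision problem on pairs `(G, k)`. -/
abbrev GraphProblem : Type := ∀ n : ℕ, SimpleGraph (Fin n) → ℕ → Prop

/-- The problem `Q`, parameterized by the vertex cover number, admits a kernel with at most `B t`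
vertices: a polynomial-time algorithm maps every instance to an equivalent instance of the same
problem whose graph has at most `B t` vertices, and whose total size is bounded by a computable
function of the parameter `t` of the given instance. -/
def AdmitsKernel (Q : GraphProblem) (B : ℕ → ℕ) : Prop :=
  ∃ (P : Prog) (p : Polynomial ℕ) (g : ℕ → ℕ), Computable g ∧
    ∀ I : Inst, I.Valid → ∃ J : Inst, J.Valid ∧
      P.OutputsWithin I.encode J.encode (p.eval (bitSize I.encode)) ∧
      (Q I.n I.G I.k ↔ Q J.n J.G J.k) ∧
      J.n ≤ B I.t ∧
      bitSize J.encode ≤ g I.t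

/-- Do `k` cops have a winning strategy in Fully Active Cops and Robber on `G`? -/
def FullyActiveCnR : GraphProblem := fun _ G k => (fullyActive G k).CopsWin

/-- Do `k` cops have a winning strategy against a robber of speed `s` on `G`? -/
def CopsAndFastRobber (s : ℕ) : GraphProblem := fun _ G k => (fastRobber s G k).CopsWin

/-- Do `k` cops have a winning strategy in Surrounding Cops and Robber on `G`? -/
def SurroundingCnR : GraphProblem := fun _ G k => (surrounding G k).CopsWin

end CopsKernel

namespace CopsKernel

/-! ### Transfer of winning strategies -/

/-! If `k ≥ t`, the cops can occupy a vertex cover. A robber off the cover then has only cops as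
neighbours: he is surrounded at once in the surrounding game, and in the other two games an adjacent
cop captures him on the first move. Such an instance is replaced by a fixed one-vertex instance that
the cops win.

If `k < t`, only the first `t` vertices of each class of false twins (vertices with equal open
neighbourhoods) are kept. Since `k < t`, every deleted vertex has a kept twin that no cop occupies,
whatever the placement of the cops on kept vertices; this is `KeepsTwins`. Winning strategies then
transfer both ways. From the kept graph to `G` (`Game.CopsWin.extend`), the cops stay on kept
vertices and treat a robber on a deleted vertex as if he stood on a free kept twin; exchanging the
two twins is an automorphism of `G` that fixes all cops, so both positions have the same outcome.
From `G` to the kept graph (`Game.CopsWin.retract`), sending each vertex to a kept twin is a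
homomorphism that fixes the kept vertices, and the cops play the images of their moves in `G`.

Outside a cover of at most `t` vertices, a kept vertex is determined by its neighbourhood, a subset
of the cover, and its rank below `t` in its class. Hence at most `t + t * 2 ^ t` vertices are kept
(`keptCount_le`). Comparing rows of the adjacency matrix finds them in cubic time
(`run_kernelProg`). -/

/-- Every vertex outside the range of `e` has, in that range, a false twin that avoids any given
`k` vertices. -/
def KeepsTwins {V W : Type} (G : SimpleGraph V) (e : W ↪ V) (k : ℕ) : Prop :=
  ∀ v, v ∉ Set.range e → ∀ c : Fin k → W,
    ∃ u, (∀ w, G.Adj (e u) w ↔ G.Adj v w) ∧ ∀ i, c i ≠ u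

section Transfer

variable {V W : Type} {G : SimpleGraph V} {e : W ↪ V} {k : ℕ}

/-- Exchanging two false twins is an automorphism. -/
def swapTwins [DecidableEq V] (G : SimpleGraph V) {u v : V} (h : ∀ w, G.Adj u w ↔ G.Adj v w) :
    G ≃g G where
  toEquiv := Equiv.swap u v
  map_rel_iff' := by
    -- Adjacent twins would give `v` a loop.
    have huv : ¬ G.Adj u v := fun h' => G.loopless.irrefl v ((h v).1 h')
    intro a b
    have h2 : ∀ w, G.Adj w u ↔ G.Adj w v := fun w => by
      rw [G.adj_comm w u, G.adj_comm w v]; exact h w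
    simp only [Equiv.swap_apply_def]
    split_ifs <;> grind [G.adj_comm, G.irrefl]

/-- A kept vertex represents itself, a deleted one is represented by a free twin. Hence a cop on the
representative can only be a cop on `v` itself, and the automorphism is the identity or the exchange
of the two twins. -/
theorem KeepsTwins.exists_representative (hT : KeepsTwins G e k) (c : Fin k → W) (v : V) :
    ∃ u, (∀ w, G.Adj (e u) w ↔ G.Adj v w) ∧ (∀ i, c i = u → e (c i) = v) ∧
      ∃ σ : G ≃g G, (∀ i, σ (e (c i)) = e (c i)) ∧ σ (e u) = v := by
  classical
  by_cases hv : v ∈ Set.range e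
  · obtain ⟨u, rfl⟩ := hv
    exact ⟨u, fun _ => Iff.rfl, fun i hi => by rw [hi], RelIso.refl _, fun _ => rfl, rfl⟩
  · obtain ⟨u, hu, hc⟩ := hT v hv c
    refine ⟨u, hu, fun i hi => absurd hi (hc i), swapTwins G hu, fun i => ?_, ?_⟩
    · exact Equiv.swap_apply_of_ne_of_ne (fun h => hc i (e.injective h)) (fun h => hv ⟨_, h⟩)
    · exact Equiv.swap_apply_left _ _

/-- Here the twin is chosen independently of the cops, which makes the choice a map. It preserves
adjacency because each end of an edge can be replaced in turn by a twin. -/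
theorem KeepsTwins.exists_retraction [Nonempty W] (hT : KeepsTwins G e k) :
    ∃ f : V → W, (∀ u, f (e u) = u) ∧ ∀ a b, G.Adj a b → (G.comap e).Adj (f a) (f b) := by
  classical
  have h : ∀ v, ∃ u, (∀ w, G.Adj (e u) w ↔ G.Adj v w) ∧ ∀ x, v = e x → u = x := by
    intro v
    by_cases hv : v ∈ Set.range e
    · obtain ⟨u, rfl⟩ := hv
      exact ⟨u, fun _ => Iff.rfl, fun x hx => e.injective hx⟩
    · obtain ⟨u, hu, -⟩ := hT v hv fun _ => Classical.arbitrary W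
      exact ⟨u, hu, fun x hx => absurd ⟨x, hx.symm⟩ hv⟩
  choose f hf hfe using h
  refine ⟨f, fun u => hfe _ _ rfl, fun a b hab => ?_⟩
  rw [SimpleGraph.comap_adj, hf a, G.adj_comm, hf b]
  exact hab.symm

/-- For robber moves an equivalence is needed: every answer of the robber in the image position must
come from an answer in the original one. -/
theorem Game.Forced.map_iso {X : Game V k} (σ : G ≃g G)
    (won : ∀ c r, X.won c r → X.won (σ ∘ c) (σ r))
    (cop : ∀ c c', X.copMove c c' → X.copMove (σ ∘ c) (σ ∘ c'))
    (rob : ∀ c r r', X.robberMove (σ ∘ c) (σ r) (σ r') ↔ X.robberMove c r r')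
    {c : Fin k → V} {r : V} (h : X.Forced c r) : X.Forced (σ ∘ c) (σ r) := by
  induction h with
  | already h => exact .already (won _ _ h)
  | finish c' hc h => exact .finish _ (cop _ _ hc) (won _ _ h)
  | step c' hc hr h ih =>
    obtain ⟨r', hr'⟩ := hr
    refine .step _ (cop _ _ hc) ⟨_, (rob _ _ _).2 hr'⟩ fun y hy => ?_
    obtain ⟨x, rfl⟩ := σ.surjective y
    exact ih x ((rob _ _ _).1 hy)

/-- The cops of `X` follow the strategy of `Y` on the range of `e`. Each time the robber moves to
some `v`, `rob` supplies a shadow `e u` that is legal in `Y`, and the automorphism carries the win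
from the shadow to `v`. -/
theorem Game.CopsWin.extend {X : Game V k} {Y : Game W k}
    (sym : ∀ (σ : G ≃g G) c r, X.Forced c r → X.Forced (σ ∘ c) (σ r))
    (won : ∀ c r, Y.won c r → X.won (e ∘ c) (e r))
    (cop : ∀ c c', Y.copMove c c' → X.copMove (e ∘ c) (e ∘ c'))
    (robLift : ∀ c r r', Y.robberMove c r r' → X.robberMove (e ∘ c) (e r) (e r'))
    (rob : ∀ c r v, X.robberMove (e ∘ c) (e r) v → ∃ u, Y.robberMove c r u ∧
      ∃ σ : G ≃g G, (∀ i, σ (e (c i)) = e (c i)) ∧ σ (e u) = v)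
    (start : ∀ c v, X.start (e ∘ c) v → ∃ u, Y.start c u ∧
      ∃ σ : G ≃g G, (∀ i, σ (e (c i)) = e (c i)) ∧ σ (e u) = v)
    (h : Y.CopsWin) : X.CopsWin := by
  have key : ∀ c v u, X.Forced (e ∘ c) (e u) →
      (∃ σ : G ≃g G, (∀ i, σ (e (c i)) = e (c i)) ∧ σ (e u) = v) → X.Forced (e ∘ c) v := by
    rintro c v u hf ⟨σ, hσ, rfl⟩
    have := sym σ _ _ hf
    rwa [show σ ∘ (e ∘ c) = e ∘ c from funext hσ] at this
  have main : ∀ c r, Y.Forced c r → X.Forced (e ∘ c) (e r) := by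
    intro c r hf
    induction hf with
    | already h => exact .already (won _ _ h)
    | finish c' hc h => exact .finish _ (cop _ _ hc) (won _ _ h)
    | step c' hc hr h ih =>
      obtain ⟨r', hr'⟩ := hr
      refine .step _ (cop _ _ hc) ⟨_, robLift _ _ _ hr'⟩ fun v hv => ?_
      obtain ⟨u, hu, hσ⟩ := rob _ _ _ hv
      exact key _ _ _ (ih u hu) hσ
  obtain ⟨c, hc⟩ := h
  refine ⟨e ∘ c, fun v hv => ?_⟩
  obtain ⟨u, hu, hσ⟩ := start _ _ hv
  exact key _ _ _ (main _ _ (hc u hu)) hσ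

/-- The robber of `Y` is seen in `X` through `e`, the cops of `X` are seen in `Y` through `f`. As a
robber without a legal move is not beaten, `rob` must rule out that passing to `Y` leaves him stuck
without being caught. -/
theorem Game.CopsWin.retract {X : Game V k} {Y : Game W k} (f : V → W)
    (won : ∀ c r, X.won c (e r) → Y.won (f ∘ c) r)
    (cop : ∀ c c', X.copMove c c' → Y.copMove (f ∘ c) (f ∘ c'))
    (robLift : ∀ c r r', Y.robberMove (f ∘ c) r r' → X.robberMove c (e r) (e r'))
    (rob : ∀ c r v, X.robberMove c (e r) v →
      (∃ r', Y.robberMove (f ∘ c) r r') ∨ Y.won (f ∘ c) r)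
    (start : ∀ c r, Y.start (f ∘ c) r → X.start c (e r))
    (h : X.CopsWin) : Y.CopsWin := by
  have main : ∀ c v, X.Forced c v → ∀ r, v = e r → Y.Forced (f ∘ c) r := by
    intro c v hf
    induction hf with
    | already h => rintro r rfl; exact .already (won _ _ h)
    | finish c' hc h => rintro r rfl; exact .finish _ (cop _ _ hc) (won _ _ h)
    | step c' hc hr h ih =>
      rintro r rfl
      obtain ⟨v, hv⟩ := hr
      rcases rob _ _ _ hv with hr' | hw
      · exact .step _ (cop _ _ hc) hr' fun r' hr' => ih _ (robLift _ _ _ hr') _ rfl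
      · exact .finish _ (cop _ _ hc) hw
  obtain ⟨c, hc⟩ := h
  exact ⟨f ∘ c, fun r hr => main _ _ (hc _ (start _ _ hr)) _ rfl⟩

end Transfer

/-! ### The three games and false twins -/

section Twins

variable {V W : Type} {G : SimpleGraph V} {e : W ↪ V} {k : ℕ}

theorem fullyActive_copsWin_comap_iff [Nonempty W] (hT : KeepsTwins G e k) :
    (fullyActive G k).CopsWin ↔ (fullyActive (G.comap e) k).CopsWin := by
  obtain ⟨f, hfe, hf⟩ := hT.exists_retraction
  constructor
  · refine Game.CopsWin.retract (e := e) f ?_ ?_ ?_ ?_ ?_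
    · rintro c r ⟨i, hi⟩
      exact ⟨i, by simp [hi, hfe]⟩
    · exact fun c c' h i => hf _ _ (h i)
    · exact fun c r r' h => h
    · exact fun c r v h => .inl ⟨f v, by simpa [hfe] using! hf _ _ h⟩
    · exact fun _ _ _ => trivial
  · refine Game.CopsWin.extend (G := G) (e := e) ?_ ?_ ?_ ?_ ?_ ?_
    · intro σ c r h
      refine h.map_iso σ ?_ ?_ ?_
      · rintro c r ⟨i, hi⟩
        exact ⟨i, congrArg σ hi⟩
      · exact fun c c' h i => σ.map_rel_iff.2 (h i)
      · exact fun c r r' => σ.map_rel_iff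
    · rintro c r ⟨i, hi⟩
      exact ⟨i, congrArg e hi⟩
    · exact fun c c' h => h
    · exact fun c r r' h => h
    · intro c r v h
      obtain ⟨u, hu, -, hσ⟩ := hT.exists_representative c v
      exact ⟨u, ((hu _).2 (SimpleGraph.Adj.symm h)).symm, hσ⟩
    · intro c v _
      obtain ⟨u, -, -, hσ⟩ := hT.exists_representative c v
      exact ⟨u, trivial, hσ⟩

theorem surrounding_copsWin_comap_iff [Nonempty W] (hT : KeepsTwins G e k) :
    (surrounding G k).CopsWin ↔ (surrounding (G.comap e) k).CopsWin := by
  obtain ⟨f, hfe, hf⟩ := hT.exists_retraction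
  have hne : ∀ (c : Fin k → V) (r : W), (∀ i, (f ∘ c) i ≠ r) → ∀ i, c i ≠ e r :=
    fun c r h i hi => h i (by simp [hi, hfe])
  constructor
  · refine Game.CopsWin.retract (e := e) f ?_ ?_ ?_ ?_ ?_
    · intro c r h u hu
      obtain ⟨i, hi⟩ := h (e u) hu
      exact ⟨i, by simp [hi, hfe]⟩
    · exact fun c c' h i => (h i).imp (congrArg f) (hf _ _)
    · exact fun c r r' h => ⟨h.1.imp (congrArg e) id, hne _ _ h.2⟩
    · intro c r v _
      -- If no neighbour is free for the robber, all of them are occupied, which is the winning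
      -- position.
      by_contra! hcon
      obtain ⟨h1, h2⟩ := hcon
      refine h2 fun u hu => ?_
      by_contra! h3
      exact h1 u ⟨.inr hu, h3⟩
    · exact hne
  · have hocc : ∀ (c : Fin k → W) (v : V) (u : W), (∀ i, (e ∘ c) i ≠ v) →
        (∀ i, c i = u → e (c i) = v) → ∀ i, c i ≠ u := fun c v u h h' i hi => h i (h' i hi)
    refine Game.CopsWin.extend (G := G) (e := e) ?_ ?_ ?_ ?_ ?_ ?_
    · intro σ c r h
      refine h.map_iso σ ?_ ?_ ?_
      · intro c r h u hu
        obtain ⟨x, rfl⟩ := σ.surjective u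
        obtain ⟨i, hi⟩ := h x (σ.map_rel_iff.1 hu)
        exact ⟨i, congrArg σ hi⟩
      · exact fun c c' h i => (h i).imp (congrArg σ) σ.map_rel_iff.2
      · intro c r r'
        simp only [surrounding, Function.comp_apply, ne_eq, EmbeddingLike.apply_eq_iff_eq]
        rw [σ.map_adj_iff]
    · intro c r h v hv
      -- A deleted neighbour `v` would have a free kept twin `u` next to `r`, so a robber surrounded
      -- in the kept graph has no deleted neighbour.
      obtain ⟨u, hu, hocc, -⟩ := hT.exists_representative c v
      obtain ⟨i, hi⟩ := h u ((hu _).2 (SimpleGraph.Adj.symm hv)).symm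
      exact ⟨i, hocc i hi⟩
    · exact fun c c' h i => (h i).imp (congrArg e) id
    · exact fun c r r' h => ⟨h.1.imp (congrArg e) id, fun i hi => h.2 i (e.injective hi)⟩
    · rintro c r v ⟨hv | hv, hc⟩
      · exact ⟨r, ⟨.inl rfl, fun i hi => hc i (by simp [hv, hi])⟩,
          RelIso.refl _, fun _ => rfl, hv.symm⟩
      · obtain ⟨u, hu, ho, hσ⟩ := hT.exists_representative c v
        exact ⟨u, ⟨.inr ((hu _).2 hv.symm).symm, hocc _ _ _ hc ho⟩, hσ⟩
    · intro c v hc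
      obtain ⟨u, hu, ho, hσ⟩ := hT.exists_representative c v
      exact ⟨u, hocc _ _ _ hc ho, hσ⟩

/-- A walk that avoids the cops can be replaced by one inside the range of `e`, from any false twin
of its first vertex to the prescribed false twin of its last one. -/
theorem exists_walk_representatives {c : Fin k → W} (g : V → W)
    (hg : ∀ v w, G.Adj (e (g v)) w ↔ G.Adj v w) (hgc : ∀ v i, c i = g v → e (c i) = v)
    {a b : V} (p : G.Walk a b) (hp : ∀ v ∈ p.support, ∀ i, e (c i) ≠ v) :
    ∃ q : (G.comap e).Walk (g a) (g b), q.length = p.length ∧ ∀ u ∈ q.support, ∀ i, c i ≠ u := by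
  induction p with
  | nil =>
    refine ⟨.nil, rfl, fun u hu i hi => ?_⟩
    rw [SimpleGraph.Walk.support_nil, List.mem_singleton] at hu
    exact hp _ (by simp) i (hgc _ i (hi.trans hu))
  | @cons a v b h p ih =>
    obtain ⟨q, hq, hs⟩ := ih fun v hv => hp v (by simp [hv])
    refine ⟨.cons ?_ q, by rw [SimpleGraph.Walk.length_cons, SimpleGraph.Walk.length_cons, hq],
      fun u hu i hi => ?_⟩
    · rw [SimpleGraph.comap_adj, hg, G.adj_comm, hg]
      exact h.symm
    · rw [SimpleGraph.Walk.support_cons, List.mem_cons] at hu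
      rcases hu with rfl | hu
      · exact hp _ (by simp) i (hgc _ i hi)
      · exact hs u hu i hi

theorem fastRobber_robberMove_map {s : ℕ} {H : SimpleGraph W} (φ : H →g G)
    (hφ : Function.Injective φ) {r r' : W} (p : H.Walk r r') {c : Fin k → V} (hp : p.IsPath)
    (hs : p.length ≤ s) (hc : ∀ u ∈ p.support, ∀ i, c i ≠ φ u) :
    (fastRobber s G k).robberMove c (φ r) (φ r') := by
  refine ⟨p.map φ, hp.map hφ, by simpa using hs, fun v hv => ?_⟩
  rw [SimpleGraph.Walk.support_map, List.mem_map] at hv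
  obtain ⟨u, hu, rfl⟩ := hv
  exact hc u hu

theorem fastRobber_copsWin_comap_iff (s : ℕ) [Nonempty W] (hT : KeepsTwins G e k) :
    (fastRobber s G k).CopsWin ↔ (fastRobber s (G.comap e) k).CopsWin := by
  obtain ⟨f, hfe, hf⟩ := hT.exists_retraction
  have hlift : ∀ {r r' : W} (p : (G.comap e).Walk r r') (c : Fin k → V), p.IsPath → p.length ≤ s →
      (∀ u ∈ p.support, ∀ i, c i ≠ e u) → (fastRobber s G k).robberMove c (e r) (e r') :=
    fun p c h1 h2 h3 =>
      fastRobber_robberMove_map (SimpleGraph.Embedding.comap e G).toHom e.injective p h1 h2 h3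
  constructor
  · refine Game.CopsWin.retract (e := e) f ?_ ?_ ?_ ?_ ?_
    · rintro c r ⟨i, hi⟩
      exact ⟨i, by simp [hi, hfe]⟩
    · exact fun c c' h i => (h i).imp (congrArg f) (hf _ _)
    · rintro c r r' ⟨p, h1, h2, h3⟩
      exact hlift p c h1 h2 fun u hu i hi => h3 u hu i (by simp [hi, hfe])
    · intro c r v _
      by_cases hw : ∃ i, (f ∘ c) i = r
      · exact .inr hw
      · push Not at hw
        -- A robber who is not caught may stay, along the path without edges.
        exact .inl ⟨r, .nil, .nil, by simp, by simpa using hw⟩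
    · exact fun _ _ _ => trivial
  · refine Game.CopsWin.extend (G := G) (e := e) ?_ ?_ ?_ ?_ ?_ ?_
    · intro σ c r h
      have hmap : ∀ (σ : G ≃g G) c r r', (fastRobber s G k).robberMove c r r' →
          (fastRobber s G k).robberMove (σ ∘ c) (σ r) (σ r') := by
        rintro σ c r r' ⟨p, h1, h2, h3⟩
        exact fastRobber_robberMove_map σ.toHom σ.injective p h1 h2
          fun u hu i hi => h3 u hu i (σ.injective hi)
      refine h.map_iso σ ?_ ?_ ?_
      · rintro c r ⟨i, hi⟩
        exact ⟨i, congrArg σ hi⟩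
      · exact fun c c' h i => (h i).imp (congrArg σ) σ.map_rel_iff.2
      · refine fun c r r' => ⟨fun h => ?_, hmap σ c r r'⟩
        have := hmap σ.symm _ _ _ h
        simpa [← Function.comp_assoc, Function.comp_def] using this
    · rintro c r ⟨i, hi⟩
      exact ⟨i, congrArg e hi⟩
    · exact fun c c' h i => (h i).imp (congrArg e) id
    · rintro c r r' ⟨p, h1, h2, h3⟩
      exact hlift p _ h1 h2 fun u hu i hi => h3 u hu i (e.injective hi)
    · classical
      rintro c r v ⟨p, -, h2, h3⟩
      choose g hg hgc hσ using hT.exists_representative c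
      have hr : ∀ i, c i ≠ r := fun i hi => h3 (e r) (by simp) i (congrArg e hi)
      -- The first vertex is treated apart: the shadow path must start at `r`, while `g (e r)` is
      -- only known to be some twin of it. Representatives of distinct vertices may coincide, so
      -- this yields a walk, which `bypass` then shortens to a path.
      have : ∃ u, (∃ q : (G.comap e).Walk r u, q.length ≤ s ∧ ∀ u ∈ q.support, ∀ i, c i ≠ u) ∧
          ∃ σ : G ≃g G, (∀ i, σ (e (c i)) = e (c i)) ∧ σ (e u) = v := by
        cases p with
        | nil => exact ⟨r, ⟨.nil, by simp, by simpa using hr⟩, RelIso.refl _, fun _ => rfl, rfl⟩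
        | @cons _ w _ h p =>
          obtain ⟨q, hq, hs⟩ := exists_walk_representatives g hg hgc p
            fun v hv => h3 v (by simp [hv])
          refine ⟨g v, ⟨.cons ?_ q, ?_, fun u hu i hi => ?_⟩, hσ v⟩
          · rw [SimpleGraph.comap_adj, G.adj_comm, hg]
            exact h.symm
          · simpa [hq] using h2
          · rw [SimpleGraph.Walk.support_cons, List.mem_cons] at hu
            rcases hu with rfl | hu
            · exact hr i hi
            · exact hs u hu i hi
      obtain ⟨u, ⟨q, h1, h2⟩, hσ⟩ := this
      exact ⟨u, ⟨q.bypass, q.bypass_isPath, q.length_bypass_le_length.trans h1,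
        fun u hu => h2 u (q.support_bypass_subset_support hu)⟩, hσ⟩
    · intro c v _
      obtain ⟨u, -, -, hσ⟩ := hT.exists_representative c v
      exact ⟨u, trivial, hσ⟩

end Twins

/-! ### Cops on a vertex cover -/

section Cover

variable {n k : ℕ} {G : SimpleGraph (Fin n)}

theorem exists_placement_on_cover (hG : G.Connected) (hc : G.vertexCoverNum ≤ (k : ℕ∞)) :
    ∃ c : Fin k → Fin n, G.IsVertexCover (Set.range c) := by
  classical
  obtain ⟨C, hC, hcov⟩ := G.vertexCoverNum_exists
  have hcard : C.toFinset.card ≤ k := by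
    rw [← hC, Set.encard_eq_coe_toFinset_card] at hc
    exact_mod_cast hc
  have : Nonempty (Fin n) := hG.nonempty
  obtain ⟨g, hg⟩ : ∃ g : Fin k → Fin n, ∀ v ∈ C, ∃ i, g i = v := by
    let eq := C.toFinset.equivFin
    -- Surplus cops are placed on an arbitrary vertex.
    refine ⟨fun i => if h : i.1 < C.toFinset.card then (eq.symm ⟨i, h⟩).1
      else Classical.arbitrary _, fun v hv => ?_⟩
    refine ⟨⟨eq ⟨v, by simpa using hv⟩, (eq _).2.trans_le hcard⟩, ?_⟩
    refine (dif_pos (eq _).2).trans ?_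
    simp
  exact ⟨g, hcov.subset fun v hv => hg v hv⟩

theorem exists_adj_of_ne (hG : G.Connected) {a b : Fin n} (hab : a ≠ b) (v : Fin n) :
    ∃ w, G.Adj v w := by
  have : Nontrivial (Fin n) := ⟨a, b, hab⟩
  exact hG.preconnected.exists_adj_of_nontrivial v

theorem fullyActive_copsWin_of_cover (hG : G.Connected) (hk : 1 ≤ k)
    (hc : G.vertexCoverNum ≤ (k : ℕ∞)) : (fullyActive G k).CopsWin := by
  classical
  obtain ⟨c, hcov⟩ := exists_placement_on_cover hG hc
  refine ⟨c, fun r _ => ?_⟩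
  by_cases hr : r ∈ Set.range c
  · exact .already hr
  -- A cop elsewhere shows that there are two vertices, so by connectedness every cop has a
  -- neighbour to move to.
  have hne : r ≠ c ⟨0, hk⟩ := fun h => hr ⟨_, h.symm⟩
  choose nb hnb using exists_adj_of_ne hG hne
  obtain ⟨i, hi⟩ := (hcov (hnb r)).resolve_left hr
  refine .finish (fun j => if j = i then r else nb (c j)) (fun j => ?_) ⟨i, by simp⟩
  by_cases hj : j = i
  · subst hj
    simpa [hi] using (hnb r).symm
  · simpa [hj] using hnb (c j)

theorem fastRobber_copsWin_of_cover (s : ℕ) (hG : G.Connected) (hk : 1 ≤ k)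
    (hc : G.vertexCoverNum ≤ (k : ℕ∞)) : (fastRobber s G k).CopsWin := by
  classical
  obtain ⟨c, hcov⟩ := exists_placement_on_cover hG hc
  refine ⟨c, fun r _ => ?_⟩
  by_cases hr : r ∈ Set.range c
  · exact .already hr
  have hne : r ≠ c ⟨0, hk⟩ := fun h => hr ⟨_, h.symm⟩
  obtain ⟨w, hw⟩ := exists_adj_of_ne hG hne r
  obtain ⟨i, hi⟩ := (hcov hw).resolve_left hr
  refine .finish (fun j => if j = i then r else c j) (fun j => ?_) ⟨i, by simp⟩
  by_cases hj : j = i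
  · subst hj
    right
    simpa [hi] using hw.symm
  · simp [hj]

theorem surrounding_copsWin_of_cover (hG : G.Connected) (hc : G.vertexCoverNum ≤ (k : ℕ∞)) : (surrounding G k).CopsWin := by
  obtain ⟨c, hcov⟩ := exists_placement_on_cover hG hc
  refine ⟨c, fun r hr => .already fun u hu => ?_⟩
  exact (hcov hu).resolve_left fun ⟨i, hi⟩ => hr i hi

end Cover

/-! ### The kept vertices

The reduction keeps a vertex if fewer than `t` smaller vertices have the same neighbourhood. -/

/-- The rows `u` and `v` of the `n`-column table `A` agree. -/
def SameRow (A : ℕ → ℕ → ℕ) (n u v : ℕ) : Prop := ∀ w < n, A u w = A v w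

instance (A : ℕ → ℕ → ℕ) (n u v : ℕ) : Decidable (SameRow A n u v) := by
  unfold SameRow
  infer_instance

theorem SameRow.symm {A : ℕ → ℕ → ℕ} {n u v : ℕ} (h : SameRow A n u v) : SameRow A n v u :=
  fun w hw => (h w hw).symm

theorem SameRow.trans {A : ℕ → ℕ → ℕ} {n u v w : ℕ} (h : SameRow A n u v) (h' : SameRow A n v w) :
    SameRow A n u w :=
  fun x hx => (h x hx).trans (h' x hx)

/-- Fewer than `t` rows of the table above the row `v` agree with it. -/
def Kept (A : ℕ → ℕ → ℕ) (n t v : ℕ) : Prop := Nat.count (fun u => SameRow A n u v) v < t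

instance (A : ℕ → ℕ → ℕ) (n t : ℕ) : DecidablePred (Kept A n t) := fun v => by
  unfold Kept
  infer_instance

theorem count_sameRow_congr {A : ℕ → ℕ → ℕ} {n u v : ℕ} (h : SameRow A n u v) (x : ℕ) :
    Nat.count (fun y => SameRow A n y u) x = Nat.count (fun y => SameRow A n y v) x := by
  congr 1
  funext y
  exact propext ⟨fun h' => h'.trans h, fun h' => h'.trans h.symm⟩

/-- `Nat.nth p i` is a default value when at most `i` numbers satisfy `p`; the count bound excludes
this. -/
theorem nth_mem_of_lt_count {p : ℕ → Prop} [DecidablePred p] {i n : ℕ} (h : i < Nat.count p n) :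
    p (Nat.nth p i) :=
  Nat.nth_mem i fun hf => h.trans_le (Nat.count_le_card hf n)

theorem count_nth_of_lt_count {p : ℕ → Prop} [DecidablePred p] {i n : ℕ} (h : i < Nat.count p n) :
    Nat.count p (Nat.nth p i) = i :=
  Nat.count_nth fun hf => h.trans_le (Nat.count_le_card hf n)

section Graph

variable {n : ℕ} (G : SimpleGraph (Fin n)) (t : ℕ)

open Classical in
/-- The entries of the adjacency matrix. -/
noncomputable def adjEntry (x y : ℕ) : ℕ :=
  if ∃ (hx : x < n) (hy : y < n), G.Adj ⟨x, hx⟩ ⟨y, hy⟩ then 1 else 0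

open Classical in
theorem adjEntry_val (x y : Fin n) : adjEntry G x y = if G.Adj x y then 1 else 0 := by
  simp [adjEntry]

theorem sameRow_adjEntry_iff (u v : Fin n) :
    SameRow (adjEntry G) n u v ↔ ∀ w, G.Adj u w ↔ G.Adj v w := by
  constructor
  · intro h w
    have := h w w.2
    rw [adjEntry_val, adjEntry_val] at this
    split_ifs at this <;> simp_all
  · intro h w hw
    classical
    refine (adjEntry_val G u ⟨w, hw⟩).trans (Eq.trans ?_ (adjEntry_val G v ⟨w, hw⟩).symm)
    exact if_congr (h ⟨w, hw⟩) rfl rfl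

/-- The number of kept vertices. -/
noncomputable def keptCount : ℕ := Nat.count (Kept (adjEntry G) n t) n

/-- The kept vertices in increasing order. -/
noncomputable def keptEmb : Fin (keptCount G t) ↪ Fin n where
  toFun i := ⟨Nat.nth (Kept (adjEntry G) n t) i, Nat.nth_lt_of_lt_count i.2⟩
  inj' i j h := by
    have h' := congrArg (Nat.count (Kept (adjEntry G) n t)) (Fin.mk.inj_iff.1 h)
    rw [count_nth_of_lt_count i.2, count_nth_of_lt_count j.2] at h'
    exact Fin.ext h'

theorem mem_range_keptEmb {v : Fin n} (h : Kept (adjEntry G) n t v) :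
    v ∈ Set.range (keptEmb G t) :=
  ⟨⟨Nat.count (Kept (adjEntry G) n t) v, Nat.count_strict_mono h v.2⟩, Fin.ext (Nat.nth_count h)⟩

theorem kept_keptEmb (i : Fin (keptCount G t)) : Kept (adjEntry G) n t (keptEmb G t i) :=
  nth_mem_of_lt_count i.2

/-- A deleted vertex has at least `t` smaller twins. The first `t` of them have ranks `0, …, t - 1`
in their class and are therefore kept, and `k < t` cops cannot occupy them all. -/
theorem keepsTwins_keptEmb {k : ℕ} (hk : k < t) : KeepsTwins G (keptEmb G t) k := by
  intro v hv c
  have hv' : t ≤ Nat.count (fun u => SameRow (adjEntry G) n u v) v :=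
    not_lt.1 fun h => hv (mem_range_keptEmb G t h)
  have hx : ∀ j : Fin t, ∃ u : Fin (keptCount G t), (∀ w, G.Adj (keptEmb G t u) w ↔ G.Adj v w) ∧
      (keptEmb G t u : ℕ) = Nat.nth (fun u => SameRow (adjEntry G) n u v) j := by
    intro j
    have hj := j.2.trans_le hv'
    have hrow := nth_mem_of_lt_count hj
    have hlt := (Nat.nth_lt_of_lt_count hj).trans v.2
    have hkept : Kept (adjEntry G) n t
        ((⟨Nat.nth (fun u => SameRow (adjEntry G) n u v) j, hlt⟩ : Fin n) : ℕ) := by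
      change Nat.count _ (Nat.nth _ _) < t
      rw [count_sameRow_congr hrow, count_nth_of_lt_count hj]
      exact j.2
    obtain ⟨u, hu⟩ := mem_range_keptEmb G t hkept
    refine ⟨u, (sameRow_adjEntry_iff G _ _).1 ?_, by rw [hu]⟩
    rw [hu]
    exact hrow
  choose u hu hun using hx
  have hinj : Function.Injective u := by
    intro i j hij
    have h := (hun i).symm.trans ((congrArg (fun x => (keptEmb G t x : ℕ)) hij).trans (hun j))
    have h' := congrArg (Nat.count fun u => SameRow (adjEntry G) n u v) h
    rw [count_nth_of_lt_count (i.2.trans_le hv'), count_nth_of_lt_count (j.2.trans_le hv')] at h'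
    exact Fin.ext h'
  obtain ⟨j, hj⟩ : ∃ j, u j ∉ Set.range c := by
    by_contra! hall
    have h1 : (Finset.univ.image u) ⊆ Finset.univ.image c := by
      intro x hx
      obtain ⟨j, -, rfl⟩ := Finset.mem_image.1 hx
      obtain ⟨i, hi⟩ := hall j
      exact Finset.mem_image.2 ⟨i, Finset.mem_univ _, hi⟩
    have h2 := (Finset.card_le_card h1).trans Finset.card_image_le
    rw [Finset.card_image_of_injective _ hinj] at h2
    simp at h2
    omega
  exact ⟨u j, hu j, fun i hi => hj ⟨i, hi⟩⟩

theorem keptCount_pos (hn : 0 < n) (ht : 0 < t) : 0 < keptCount G t := by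
  have h0 : Kept (adjEntry G) n t 0 := by simpa [Kept] using ht
  exact (Nat.zero_le _).trans_lt (Nat.count_strict_mono h0 hn)

theorem keptCount_le_self : keptCount G t ≤ n := Nat.count_le _

theorem keptCount_le (hG : G.vertexCoverNum ≤ (t : ℕ∞)) : keptCount G t ≤ t + t * 2 ^ t := by
  classical
  obtain ⟨C, hC, hcov⟩ := G.vertexCoverNum_exists
  have hcard : C.toFinset.card ≤ t := by
    rw [← hC, Set.encard_eq_coe_toFinset_card] at hG
    exact_mod_cast hG
  let S : Finset (Fin n) := Finset.univ.map (keptEmb G t)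
  have hS : S.card = keptCount G t := by simp [S]
  have hsub : S ⊆ C.toFinset ∪ S.filter (· ∉ C) := by
    intro v hv
    by_cases h : v ∈ C <;> simp [h, hv]
  have hle : (S.filter (· ∉ C)).card ≤ (Finset.range t ×ˢ C.toFinset.powerset).card := by
    -- A vertex off the cover is coded by its rank among its twins and its neighbourhood, which lies
    -- in the cover; equal neighbourhood and equal rank force equality.
    refine Finset.card_le_card_of_injOn
      (fun v => (Nat.count (fun u => SameRow (adjEntry G) n u v) v, G.neighborFinset v)) ?_ ?_
    · intro v hv
      rw [Finset.mem_coe, Finset.mem_filter, Finset.mem_map] at hv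
      obtain ⟨⟨i, -, rfl⟩, hv⟩ := hv
      simp only [Finset.coe_product, Set.mem_prod, Finset.mem_coe, Finset.mem_range,
        Finset.mem_powerset]
      refine ⟨kept_keptEmb G t i, fun w hw => ?_⟩
      rw [SimpleGraph.mem_neighborFinset] at hw
      simpa using (hcov hw).resolve_left hv
    · intro v _ w _ hvw
      obtain ⟨h1, h2⟩ := Prod.mk.injEq .. ▸ hvw
      have hrow : SameRow (adjEntry G) n v w := (sameRow_adjEntry_iff G v w).2 fun x => by
        rw [← SimpleGraph.mem_neighborFinset, h2, SimpleGraph.mem_neighborFinset]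
      rw [count_sameRow_congr hrow] at h1
      exact Fin.ext (Nat.count_injective hrow (fun _ _ => rfl) h1)
  rw [Finset.card_product, Finset.card_range, Finset.card_powerset] at hle
  calc keptCount G t = S.card := hS.symm
    _ ≤ C.toFinset.card + (S.filter (· ∉ C)).card :=
      (Finset.card_le_card hsub).trans (Finset.card_union_le _ _)
    _ ≤ t + t * 2 ^ t := by
      refine add_le_add hcard (hle.trans (Nat.mul_le_mul_left _ ?_))
      exact Nat.pow_le_pow_right (by norm_num) hcard

end Graph

/-- The instance on the kept vertices. -/
noncomputable def Inst.reduce (I : Inst) : Inst where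
  n := keptCount I.G I.t
  G := I.G.comap (keptEmb I.G I.t)
  k := I.k
  t := I.t

theorem Inst.Valid.pos_n {I : Inst} (hI : I.Valid) : 0 < I.n :=
  Fin.pos_iff_nonempty.2 hI.connected.nonempty

theorem Inst.Valid.reduce {I : Inst} (hI : I.Valid) : I.reduce.Valid where
  connected := by
    have : Nonempty (Fin (keptCount I.G I.t)) :=
      Fin.pos_iff_nonempty.1 (keptCount_pos I.G I.t hI.pos_n hI.pos)
    -- Used with zero cops, so `1 ≤ t` suffices. The kept graph is connected as a homomorphic image
    -- of `G`.
    obtain ⟨f, hfe, hf⟩ := (keepsTwins_keptEmb I.G I.t hI.pos).exists_retraction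
    exact hI.connected.map (H := I.reduce.G) ⟨f, fun {a b} h => hf a b h⟩ fun u => ⟨_, hfe u⟩
  cover := by
    refine le_trans (SimpleGraph.IsContained.vertexCoverNum_le_vertexCoverNum ?_) hI.cover
    exact ⟨(SimpleGraph.Embedding.comap (keptEmb I.G I.t) I.G).toHom, (keptEmb I.G I.t).injective⟩
  pos := hI.pos

/-! ### Reasoning about programs -/

/-- Started in `σ`, the program `P` halts within `B` time units in a state that satisfies `Q`. -/
def Run (P : Prog) (σ : State) (B : ℕ) (Q : State → Prop) : Prop :=
  ∃ T τ, T ≤ B ∧ Exec P σ T τ ∧ Q τ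

theorem Run.mono {P : Prog} {σ : State} {B B' : ℕ} {Q Q' : State → Prop} (h : Run P σ B Q)
    (hB : B ≤ B') (hQ : ∀ τ, Q τ → Q' τ) : Run P σ B' Q' := by
  obtain ⟨T, τ, hT, hE, hτ⟩ := h
  exact ⟨T, τ, hT.trans hB, hE, hQ _ hτ⟩

theorem Run.skip {σ : State} {Q : State → Prop} (h : Q σ) : Run .skip σ 1 Q :=
  ⟨1, σ, le_rfl, .skip σ, h⟩

theorem Run.assign {σ : State} {x : ℕ} {e : Expr} {Q : State → Prop}
    (h : Q (σ.setReg x (e.eval σ))) : Run (.assign x e) σ (e.cost + 1) Q :=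
  ⟨_, _, le_rfl, .assign σ x e, h⟩

theorem Run.store {σ : State} {a : ℕ} {i e : Expr} {Q : State → Prop}
    (h : Q (σ.setMem a (i.eval σ) (e.eval σ))) : Run (.store a i e) σ (i.cost + e.cost + 1) Q :=
  ⟨_, _, le_rfl, .store σ a i e, h⟩

theorem Run.seq {p q : Prog} {σ : State} {B C : ℕ} {Q : State → Prop}
    (h : Run p σ B fun τ => Run q τ C Q) : Run (.seq p q) σ (B + C) Q := by
  obtain ⟨T, τ, hT, hE, U, υ, hU, hE', hυ⟩ := h
  exact ⟨_, υ, add_le_add hT hU, .seq hE hE', hυ⟩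

theorem Run.ite {e : Expr} {p q : Prog} {σ : State} {B : ℕ} {Q : State → Prop}
    (hp : e.eval σ ≠ 0 → Run p σ B Q) (hq : e.eval σ = 0 → Run q σ B Q) :
    Run (.ite e p q) σ (e.cost + 1 + B) Q := by
  by_cases he : e.eval σ = 0
  · obtain ⟨T, τ, hT, hE, hτ⟩ := hq he
    exact ⟨_, τ, by omega, .iteFalse he hE, hτ⟩
  · obtain ⟨T, τ, hT, hE, hτ⟩ := hp he
    exact ⟨_, τ, by omega, .iteTrue he hE, hτ⟩

/-- `for x := 0 to b - 1 do p`, where `x` and `b` are registers. -/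
def Prog.forTo (x b : ℕ) (p : Prog) : Prog :=
  .seq (.assign x (.const 0))
    (.loop (.sub (.reg b) (.reg x)) (.seq p (.assign x (.add (.reg x) (.const 1)))))

/-- Each round pays 4 for the test and 4 for the increment besides the body; the final 6 is the
initialization and the failing test. -/
theorem Run.forTo {x b : ℕ} {p : Prog} {σ : State} {N B : ℕ} {Q : State → Prop}
    (Inv : ℕ → State → Prop) (hx : ∀ j τ, Inv j τ → τ.reg x = j) (hb : ∀ j τ, Inv j τ → τ.reg b = N)
    (init : Inv 0 (σ.setReg x 0))
    (step : ∀ j < N, ∀ τ, Inv j τ →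
      Run p τ B fun τ' => τ'.reg x = j ∧ Inv (j + 1) (τ'.setReg x (j + 1)))
    (post : ∀ τ, Inv N τ → Q τ) : Run (Prog.forTo x b p) σ (N * (B + 8) + 6) Q := by
  have key : ∀ d j τ, j + d = N → Inv j τ →
      Run (.loop (.sub (.reg b) (.reg x)) (.seq p (.assign x (.add (.reg x) (.const 1))))) τ
        (d * (B + 8) + 4) Q := by
    intro d
    induction d with
    | zero =>
      rintro j τ rfl hI
      refine ⟨_, τ, ?_, .loopFalse ?_, post _ hI⟩
      · simp [Expr.cost]
      · simp only [Expr.eval]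
        rw [hx _ _ hI, hb _ _ hI, Nat.add_zero, Nat.sub_self]
    | succ d ih =>
      intro j τ hj hI
      obtain ⟨T, υ, hT, hE, hυ, hI'⟩ := step j (by omega) τ hI
      obtain ⟨U, ρ, hU, hE', hρ⟩ := ih (j + 1) _ (by omega) hI'
      have he : (Expr.sub (.reg b) (.reg x)).eval τ ≠ 0 := by
        simp only [Expr.eval]
        rw [hx _ _ hI, hb _ _ hI]
        omega
      have ha := Exec.assign υ x (.add (.reg x) (.const 1))
      simp only [Expr.eval, hυ] at ha
      refine ⟨_, ρ, ?_, .loopTrue he (.seq hE ha) hE', hρ⟩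
      simp only [Expr.cost]
      rw [Nat.succ_mul]
      omega
  have h := Run.seq (Run.assign (σ := σ) (x := x) (e := .const 0) (key N 0 _ (Nat.zero_add N) init))
  refine h.mono ?_ fun _ h => h
  simp only [Expr.cost]
  omega

@[simp]
theorem State.reg_setReg (σ : State) (x v y : ℕ) :
    (σ.setReg x v).reg y = if y = x then v else σ.reg y := by
  simp [State.setReg, Function.update_apply]

@[simp]
theorem State.mem_setReg (σ : State) (x v : ℕ) : (σ.setReg x v).mem = σ.mem := rfl

@[simp]
theorem State.reg_setMem (σ : State) (a i v : ℕ) : (σ.setMem a i v).reg = σ.reg := rfl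

theorem State.mem_setMem (σ : State) (a i v b j : ℕ) :
    (σ.setMem a i v).mem b j = if b = a ∧ j = i then v else σ.mem b j := by
  by_cases h : b = a
  · subst h
    simp [State.setMem, Function.update_apply]
  · simp [State.setMem, h]

/-- Two states agree on the memory and on the registers below `b`. -/
def State.AgreeBelow (b : ℕ) (σ τ : State) : Prop := τ.mem = σ.mem ∧ ∀ x < b, τ.reg x = σ.reg x

/-! ### The program

Registers: `1`, `2`, `3` hold `n`, `k`, `t`; register `4` counts the kept vertices; registers `5`
and `6` hold the current vertex and the address of its row. Array `2` lists the addresses of the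
rows of the kept vertices, array `3` the kept vertices themselves. -/

/-- Set register `11` to `0` iff the rows at the addresses in registers `6` and `9` agree. -/
def compareRows : Prog :=
  .seq (.assign 11 (.const 0)) <| .forTo 10 1 <| .assign 11 <| .add (.reg 11) <|
    .add (.sub (.load 0 (.add (.reg 6) (.reg 10))) (.load 0 (.add (.reg 9) (.reg 10))))
      (.sub (.load 0 (.add (.reg 9) (.reg 10))) (.load 0 (.add (.reg 6) (.reg 10))))

/-- Count in register `7` the smaller vertices with the row of the vertex in register `5`. -/
def countTwins : Prog :=
  .seq (.assign 7 (.const 0)) <| .seq (.assign 9 (.const 3)) <| .forTo 8 5 <|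
    .seq compareRows <|
      .seq (.ite (.reg 11) .skip (.assign 7 (.add (.reg 7) (.const 1))))
        (.assign 9 (.add (.reg 9) (.reg 1)))

/-- List the kept vertices. -/
def selectKept : Prog :=
  .seq (.assign 4 (.const 0)) <| .seq (.assign 6 (.const 3)) <| .forTo 5 1 <|
    .seq countTwins <|
      .seq (.ite (.sub (.reg 3) (.reg 7))
        (.seq (.store 2 (.reg 4) (.reg 6)) <| .seq (.store 3 (.reg 4) (.reg 5)) <|
          .assign 4 (.add (.reg 4) (.const 1)))
        .skip)
        (.assign 6 (.add (.reg 6) (.reg 1)))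

/-- Write the instance on the kept vertices. -/
def writeKept : Prog :=
  .seq (.store 1 (.const 0) (.reg 4)) <| .seq (.store 1 (.const 1) (.reg 2)) <|
    .seq (.store 1 (.const 2) (.reg 3)) <| .seq (.assign 5 (.const 3)) <|
      .seq (.forTo 6 4 <| .forTo 7 4 <|
        .seq (.store 1 (.reg 5) (.load 0 (.add (.load 2 (.reg 6)) (.load 3 (.reg 7)))))
          (.assign 5 (.add (.reg 5) (.const 1))))
        (.assign 0 (.reg 5))

/-- Write the instance with one vertex, one cop and parameter `1`. -/
def writeTrivial : Prog :=
  .seq (.store 1 (.const 0) (.const 1)) <| .seq (.store 1 (.const 1) (.const 1)) <|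
    .seq (.store 1 (.const 2) (.const 1)) <| .seq (.store 1 (.const 3) (.const 0)) <|
      .assign 0 (.const 4)

/-- The kernelization. -/
def kernelProg : Prog :=
  .seq (.assign 1 (.load 0 (.const 0))) <| .seq (.assign 2 (.load 0 (.const 1))) <|
    .seq (.assign 3 (.load 0 (.const 2))) <|
      .ite (.sub (.reg 3) (.reg 2)) (.seq selectKept writeKept) writeTrivial

/-! ### Effect and running time of the subprograms -/

theorem run_compareRows {A : ℕ → ℕ → ℕ} {σ : State} {n u v : ℕ} (h1 : σ.reg 1 = n)
    (h6 : ∀ w < n, σ.mem 0 (σ.reg 6 + w) = A v w) (h9 : ∀ w < n, σ.mem 0 (σ.reg 9 + w) = A u w) :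
    Run compareRows σ (n * 30 + 8)
      fun τ => σ.AgreeBelow 10 τ ∧ (τ.reg 11 = 0 ↔ SameRow A n u v) := by
  refine Run.mono (Run.seq (Run.assign (Run.forTo (N := n) (B := 22) (fun j τ => σ.AgreeBelow 10 τ ∧
    τ.reg 10 = j ∧ (τ.reg 11 = 0 ↔ SameRow A j u v)) (fun j τ h => h.2.1)
    (fun j τ h => (h.1.2 1 (by norm_num)).trans h1) ?_ ?_ fun τ h => ⟨h.1, h.2.2⟩))) ?_ fun _ h => h
  · refine ⟨⟨rfl, fun x hx => ?_⟩, ?_, ?_⟩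
    · simp [show x ≠ 10 by omega, show x ≠ 11 by omega]
    · simp
    · simp [Expr.eval, SameRow]
  · rintro j hj τ ⟨⟨hm, hr⟩, hj', he⟩
    refine Run.mono (Run.assign ?_) (by simp [Expr.cost]) fun _ h => h
    refine ⟨by simp [hj'], ⟨hm, fun x hx => ?_⟩, by simp, ?_⟩
    · simpa [show x ≠ 10 by omega, show x ≠ 11 by omega] using hr x hx
    · simp only [Expr.eval, State.reg_setReg, hm, hr 6 (by norm_num), hr 9 (by norm_num), hj',
        h6 j hj, h9 j hj]
      -- Register `11` sums the two opposite truncated differences of the entries; such a sum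
      -- vanishes only if the entries are equal.
      have hs : SameRow A (j + 1) u v ↔ SameRow A j u v ∧ A u j = A v j := by
        constructor
        · exact fun h => ⟨fun w hw => h w (by omega), h j (by omega)⟩
        · rintro ⟨h, h'⟩ w hw
          rcases Nat.lt_succ_iff_lt_or_eq.1 hw with hw | rfl
          · exact h w hw
          · exact h'
      rw [hs, ← he]
      norm_num
      omega
  · simp only [Expr.cost]
    omega

/-- The memory holds the `n × n` table `A` from address `3` of array `0` on. -/
def State.HoldsTable (σ : State) (A : ℕ → ℕ → ℕ) (n : ℕ) : Prop :=
  ∀ x < n, ∀ y < n, σ.mem 0 (3 + x * n + y) = A x y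

/-- The loop invariant includes the address `3 + j * n` of row `j` in register `9`, advanced by `n`
in each round since the machine cannot multiply. -/
theorem run_countTwins {A : ℕ → ℕ → ℕ} {σ : State} {n v : ℕ} (hA : σ.HoldsTable A n) (hv : v < n)
    (h1 : σ.reg 1 = n) (h5 : σ.reg 5 = v) (h6 : σ.reg 6 = 3 + v * n) :
    Run countTwins σ (n * (n * 30 + 26) + 10)
      fun τ => σ.AgreeBelow 7 τ ∧ τ.reg 7 = Nat.count (fun u => SameRow A n u v) v := by
  refine Run.mono (Run.seq (Run.assign (Run.seq (Run.assign (Run.forTo (N := v) (B := n * 30 + 18)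
    (fun j τ => σ.AgreeBelow 7 τ ∧ τ.reg 8 = j ∧ τ.reg 9 = 3 + j * n ∧
      τ.reg 7 = Nat.count (fun u => SameRow A n u v) j) (fun j τ h => h.2.1)
    (fun j τ h => (h.1.2 5 (by norm_num)).trans h5) ?_ ?_ fun τ h => ⟨h.1, h.2.2.2⟩)))))
    ?_ fun _ h => h
  · refine ⟨⟨rfl, fun x hx => ?_⟩, ?_, ?_, ?_⟩
    · simp [show x ≠ 7 by omega, show x ≠ 8 by omega, show x ≠ 9 by omega]
    · simp
    · simp [Expr.eval]
    · simp [Expr.eval]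
  · rintro j hj τ ⟨⟨hm, hr⟩, h8, h9, h7⟩
    have hr1 := (hr 1 (by norm_num)).trans h1
    have hr6 := (hr 6 (by norm_num)).trans h6
    refine Run.mono (Run.seq (C := 10) (Run.mono (run_compareRows (A := A) (u := j) (v := v) hr1 ?_ ?_)
      le_rfl ?_)) (by omega) fun _ h => h
    · intro w hw
      rw [hm, hr6]
      exact hA v hv w hw
    · intro w hw
      rw [hm, h9]
      exact hA j (hj.trans hv) w hw
    · rintro υ ⟨⟨hm', hr'⟩, he⟩
      -- Both branches of the conditional are followed by the same assignment, treated once for any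
      -- state `ρ` they reach.
      have key : ∀ ρ : State, υ.AgreeBelow 7 ρ → ρ.reg 8 = j → ρ.reg 9 = 3 + j * n →
          ρ.reg 7 = Nat.count (fun u => SameRow A n u v) (j + 1) →
          Run (.assign 9 (.add (.reg 9) (.reg 1))) ρ 4 fun τ' => τ'.reg 8 = j ∧
            σ.AgreeBelow 7 (τ'.setReg 8 (j + 1)) ∧ (τ'.setReg 8 (j + 1)).reg 8 = j + 1 ∧
            (τ'.setReg 8 (j + 1)).reg 9 = 3 + (j + 1) * n ∧
            (τ'.setReg 8 (j + 1)).reg 7 = Nat.count (fun u => SameRow A n u v) (j + 1) := by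
        rintro ρ ⟨hm'', hr''⟩ g8 g9 g7
        refine Run.assign ⟨by simp [g8], ⟨?_, fun x hx => ?_⟩, by simp, ?_, by simp [g7]⟩
        · exact hm''.trans (hm'.trans hm)
        · simpa [show x ≠ 8 by omega, show x ≠ 9 by omega] using
            (hr'' x hx).trans ((hr' x (by omega)).trans (hr x hx))
        · have := (hr'' 1 (by norm_num)).trans ((hr' 1 (by norm_num)).trans hr1)
          simp [Expr.eval, g9, this]
          ring
      have h7' := (hr' 7 (by norm_num)).trans h7
      have h8' := (hr' 8 (by norm_num)).trans h8
      have h9' := (hr' 9 (by norm_num)).trans h9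
      refine Run.mono (Run.seq (B := 6) (C := 4) (Run.mono (Run.ite (B := 4) (fun h => ?_) fun h => ?_)
        (by simp [Expr.cost]) fun _ h => h)) le_rfl fun _ h => h
      · refine (Run.skip (key υ ⟨rfl, fun _ _ => rfl⟩ h8' h9' ?_)).mono (by norm_num) fun _ h => h
        rw [Nat.count_succ, if_neg (fun hs => h (he.2 hs)), h7', Nat.add_zero]
      · refine Run.assign (key _ ⟨rfl, fun x hx => ?_⟩ ?_ ?_ ?_)
        · simp [show x ≠ 7 by omega]
        · simp [h8']
        · simp [h9']
        · rw [Nat.count_succ, if_pos (he.1 h)]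
          simp [Expr.eval, h7']
  · have : v * (n * 30 + 26) ≤ n * (n * 30 + 26) := Nat.mul_le_mul_right _ hv.le
    simp only [Expr.cost, Nat.add_assoc, Nat.reduceAdd]
    omega

theorem run_selectKept {A : ℕ → ℕ → ℕ} {σ : State} {n t : ℕ} (hA : σ.HoldsTable A n)
    (h1 : σ.reg 1 = n) (h3 : σ.reg 3 = t) :
    Run selectKept σ (n * (n * (n * 30 + 26) + 36) + 10) fun τ =>
      τ.mem 0 = σ.mem 0 ∧ (∀ x < 4, τ.reg x = σ.reg x) ∧ τ.reg 4 = Nat.count (Kept A n t) n ∧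
      ∀ i < Nat.count (Kept A n t) n, τ.mem 2 i = 3 + Nat.nth (Kept A n t) i * n ∧
        τ.mem 3 i = Nat.nth (Kept A n t) i := by
  refine Run.mono (Run.seq (Run.assign (Run.seq (Run.assign (Run.forTo (N := n)
    (B := n * (n * 30 + 26) + 28)
    (fun j τ => (τ.mem 0 = σ.mem 0 ∧ (∀ x < 4, τ.reg x = σ.reg x) ∧
      τ.reg 4 = Nat.count (Kept A n t) j ∧
      ∀ i < Nat.count (Kept A n t) j, τ.mem 2 i = 3 + Nat.nth (Kept A n t) i * n ∧
        τ.mem 3 i = Nat.nth (Kept A n t) i) ∧ τ.reg 5 = j ∧ τ.reg 6 = 3 + j * n)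
    (fun j τ h => h.2.1) (fun j τ h => (h.1.2.1 1 (by norm_num)).trans h1) ?_ ?_
    fun τ h => h.1))))) ?_ fun _ h => h
  · refine ⟨⟨rfl, fun x hx => ?_, ?_, ?_⟩, ?_, ?_⟩
    · simp [show x ≠ 4 by omega, show x ≠ 5 by omega, show x ≠ 6 by omega]
    · simp [Expr.eval]
    · simp
    · simp
    · simp [Expr.eval]
  · rintro j hj τ ⟨⟨hm, hr, h4, hk⟩, h5, h6⟩
    have hA' : τ.HoldsTable A n := by
      intro x hx y hy
      rw [hm]
      exact hA x hx y hy
    refine Run.mono (Run.seq (C := 18) (Run.mono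
      (run_countTwins hA' hj ((hr 1 (by norm_num)).trans h1) h5 h6) le_rfl ?_)) (by omega) fun _ h => h
    rintro υ ⟨⟨hm', hr'⟩, h7⟩
    have key : ∀ ρ : State, ρ.mem 0 = σ.mem 0 → (∀ x < 4, ρ.reg x = σ.reg x) →
        ρ.reg 4 = Nat.count (Kept A n t) (j + 1) →
        (∀ i < Nat.count (Kept A n t) (j + 1), ρ.mem 2 i = 3 + Nat.nth (Kept A n t) i * n ∧
          ρ.mem 3 i = Nat.nth (Kept A n t) i) → ρ.reg 5 = j → ρ.reg 6 = 3 + j * n →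
        Run (.assign 6 (.add (.reg 6) (.reg 1))) ρ 4 fun τ' => τ'.reg 5 = j ∧
          ((τ'.setReg 5 (j + 1)).mem 0 = σ.mem 0 ∧
            (∀ x < 4, (τ'.setReg 5 (j + 1)).reg x = σ.reg x) ∧
            (τ'.setReg 5 (j + 1)).reg 4 = Nat.count (Kept A n t) (j + 1) ∧
            ∀ i < Nat.count (Kept A n t) (j + 1),
              (τ'.setReg 5 (j + 1)).mem 2 i = 3 + Nat.nth (Kept A n t) i * n ∧
              (τ'.setReg 5 (j + 1)).mem 3 i = Nat.nth (Kept A n t) i) ∧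
          (τ'.setReg 5 (j + 1)).reg 5 = j + 1 ∧
          (τ'.setReg 5 (j + 1)).reg 6 = 3 + (j + 1) * n := by
      intro ρ g0 gr g4 gk g5 g6
      refine Run.assign ⟨by simp [g5], ⟨g0, fun x hx => ?_, by simp [g4], gk⟩, by simp, ?_⟩
      · simpa [show x ≠ 5 by omega, show x ≠ 6 by omega] using gr x hx
      · simp [Expr.eval, g6, (gr 1 (by norm_num)).trans h1]
        ring
    have hυ : ∀ x < 4, υ.reg x = σ.reg x := fun x hx => (hr' x (by omega)).trans (hr x hx)
    have h4' := (hr' 4 (by norm_num)).trans h4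
    have h5' := (hr' 5 (by norm_num)).trans h5
    have h6' := (hr' 6 (by norm_num)).trans h6
    have hkept : Kept A n t j ↔ (Expr.sub (.reg 3) (.reg 7)).eval υ ≠ 0 := by
      simp only [Expr.eval, h7, (hυ 3 (by norm_num)).trans h3, Kept]
      omega
    refine Run.mono (Run.seq (B := 14) (C := 4) (Run.mono (Run.ite (B := 10) (fun h => ?_) fun h => ?_)
      (by simp [Expr.cost]) fun _ h => h)) le_rfl fun _ h => h
    · have hj' := hkept.2 h
      have hc : Nat.count (Kept A n t) (j + 1) = Nat.count (Kept A n t) j + 1 := by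
        rw [Nat.count_succ, if_pos hj']
      refine Run.mono (Run.seq (Run.store (Run.seq (Run.store (Run.assign (key _ ?_ ?_ ?_ ?_ ?_
        ?_)))))) (by simp [Expr.cost]) fun _ h => h
      · funext i
        simp [State.mem_setMem, hm', hm]
      · intro x hx
        simpa [show x ≠ 4 by omega] using hυ x hx
      · simp [Expr.eval, h4', hc]
      · intro i hi
        simp only [Expr.eval, State.mem_setReg, State.mem_setMem, State.reg_setMem, h4', h5', h6',
          hm']
        rw [hc] at hi
        rcases Nat.lt_succ_iff_lt_or_eq.1 hi with hi' | rfl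
        · simpa [hi'.ne] using hk i hi'
        -- The new slot has index `Nat.count _ j`, and the kept vertex of that index is `j`.
        · simp [Nat.nth_count hj']
      · simp [h5']
      · simp [h6']
    · have hc : Nat.count (Kept A n t) (j + 1) = Nat.count (Kept A n t) j := by
        rw [Nat.count_succ, if_neg (fun hj' => hkept.1 hj' h), Nat.add_zero]
      refine (Run.skip (key υ ?_ hυ ?_ ?_ h5' h6')).mono (by norm_num) fun _ h => h
      · rw [hm', hm]
      · rw [h4', hc]
      · rw [hc, hm']
        exact hk
  · simp only [Expr.cost, Nat.add_assoc, Nat.reduceAdd]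
    omega

theorem run_writeKept {A : ℕ → ℕ → ℕ} {K : ℕ → ℕ} {σ : State} {n m : ℕ} (hA : σ.HoldsTable A n)
    (h4 : σ.reg 4 = m) (hK : ∀ i < m, K i < n) (h2 : ∀ i < m, σ.mem 2 i = 3 + K i * n)
    (h3 : ∀ i < m, σ.mem 3 i = K i) :
    Run writeKept σ (m * (m * 20 + 14) + 19) fun τ =>
      τ.reg 0 = 3 + m * m ∧ τ.mem 1 0 = m ∧ τ.mem 1 1 = σ.reg 2 ∧ τ.mem 1 2 = σ.reg 3 ∧
      ∀ p < m * m, τ.mem 1 (3 + p) = A (K (p / m)) (K (p % m)) := by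
  -- The first `q` matrix entries are written in row-major order; register `5` is the write address,
  -- and entry `(i, j)` has `q = i * m + j`.
  let Common : ℕ → State → Prop := fun q τ =>
    (∀ a ≠ 1, τ.mem a = σ.mem a) ∧ τ.reg 4 = m ∧ τ.reg 5 = 3 + q ∧
    τ.mem 1 0 = m ∧ τ.mem 1 1 = σ.reg 2 ∧ τ.mem 1 2 = σ.reg 3 ∧
    ∀ p < q, τ.mem 1 (3 + p) = A (K (p / m)) (K (p % m))
  have common_setReg : ∀ q τ x v, x ≠ 4 → x ≠ 5 → Common q τ → Common q (τ.setReg x v) := by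
    rintro q τ x v hx4 hx5 ⟨c1, c2, c3, c4⟩
    exact ⟨c1, by simp [hx4.symm, c2], by simp [hx5.symm, c3], c4⟩
  have main : ∀ ρ, Common 0 ρ → Run (.forTo 6 4 <| .forTo 7 4 <|
      .seq (.store 1 (.reg 5) (.load 0 (.add (.load 2 (.reg 6)) (.load 3 (.reg 7)))))
        (.assign 5 (.add (.reg 5) (.const 1)))) ρ (m * (m * 20 + 6 + 8) + 6) (Common (m * m)) := by
    intro ρ hρ
    refine Run.forTo (fun i τ => Common (i * m) τ ∧ τ.reg 6 = i) (fun _ _ h => h.2)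
      (fun _ _ h => h.1.2.1) ⟨?_, by simp⟩ ?_ fun _ h => h.1
    · rw [Nat.zero_mul]
      exact common_setReg _ _ _ _ (by norm_num) (by norm_num) hρ
    · rintro i hi τ ⟨hτ, h6⟩
      refine Run.forTo (B := 12) (fun j υ => Common (i * m + j) υ ∧ υ.reg 7 = j ∧ υ.reg 6 = i)
        (fun _ _ h => h.2.1) (fun _ _ h => h.1.2.1) ⟨?_, by simp, by simp [h6]⟩ ?_ ?_
      · exact common_setReg _ _ _ _ (by norm_num) (by norm_num) hτ
      · rintro j hj υ ⟨⟨c1, c4, c5, d0, d1, d2, hp⟩, g7, g6⟩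
        refine Run.mono (Run.seq (Run.store (Run.assign ⟨?_, common_setReg _ _ _ _ (by norm_num)
          (by norm_num) ⟨fun a ha => ?_, ?_, ?_, ?_, ?_, ?_, ?_⟩, ?_, ?_⟩)))
          (by simp [Expr.cost]) fun _ h => h
        · simp [g7]
        · funext x
          simp [State.mem_setMem, ha, c1 a ha]
        · simp [c4]
        · simp [Expr.eval, c5]
          ring
        · simpa [State.mem_setMem, Expr.eval, c5, show 0 ≠ 3 + (i * m + j) by omega] using d0
        · simpa [State.mem_setMem, Expr.eval, c5, show 1 ≠ 3 + (i * m + j) by omega] using d1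
        · simpa [State.mem_setMem, Expr.eval, c5, show 2 ≠ 3 + (i * m + j) by omega] using d2
        · intro p hp'
          simp only [State.mem_setReg, State.mem_setMem, Expr.eval, c5, g6, g7,
            c1 0 (by norm_num), c1 2 (by norm_num), c1 3 (by norm_num), h2 i hi, h3 j hj,
            hA _ (hK i hi) _ (hK j hj)]
          rcases Nat.lt_succ_iff_lt_or_eq.1 hp' with hlt | rfl
          · simpa [show p ≠ i * m + j from hlt.ne] using hp p hlt
          · have hm : 0 < m := by omega
            have e1 : (i * m + j) / m = i := by
              rw [Nat.add_comm, Nat.add_mul_div_right _ _ hm, Nat.div_eq_of_lt hj, Nat.zero_add]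
            have e2 : (i * m + j) % m = j := by
              rw [Nat.add_comm, Nat.add_mul_mod_self_right, Nat.mod_eq_of_lt hj]
            simp [e1, e2]
        · simp
        · simp [g6]
      · rintro υ ⟨hυ, -, g6⟩
        refine ⟨g6, common_setReg _ _ _ _ (by norm_num) (by norm_num) ?_, by simp⟩
        rwa [Nat.succ_mul]
  refine Run.mono (Run.seq (Run.store (Run.seq (Run.store (Run.seq (Run.store (Run.seq (Run.assign
    (Run.seq (Run.mono (main _ ?_) le_rfl fun τ hτ => Run.assign (e := .reg 5) ?_)))))))))) ?_
    fun _ h => h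
  · refine ⟨fun a ha => ?_, ?_, ?_, ?_, ?_, ?_, ?_⟩
    · funext x
      simp [State.mem_setMem, ha]
    · simp [h4]
    · simp [Expr.eval]
    all_goals simp [State.mem_setMem, Expr.eval, h4]
  · obtain ⟨-, -, c5, d0, d1, d2, hp⟩ := hτ
    exact ⟨by simp [Expr.eval, c5], d0, d1, d2, hp⟩
  · simp only [Expr.cost, Nat.add_assoc, Nat.reduceAdd]
    omega

theorem run_writeTrivial (σ : State) : Run writeTrivial σ 14 fun τ =>
    τ.reg 0 = 4 ∧ τ.mem 1 0 = 1 ∧ τ.mem 1 1 = 1 ∧ τ.mem 1 2 = 1 ∧ τ.mem 1 3 = 0 := by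
  refine Run.mono (Run.seq (Run.store (Run.seq (Run.store (Run.seq (Run.store (Run.seq (Run.store
    (Run.assign ?_))))))))) (by simp [Expr.cost]) fun _ h => h
  simp [State.mem_setMem, Expr.eval]

/-! ### Encodings -/

theorem Inst.length_encode (I : Inst) : I.encode.length = 3 + I.n * I.n := by
  simp [Inst.encode]
  omega

theorem Inst.getD_encode (I : Inst) {p : ℕ} (hp : p < I.n * I.n) :
    I.encode.getD (3 + p) 0 = adjEntry I.G (p / I.n) (p % I.n) := by
  classical
  have hn : 0 < I.n := Nat.pos_of_ne_zero fun h => by simp [h] at hp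
  have h1 : p / I.n < I.n := Nat.div_lt_of_lt_mul hp
  have h2 : p % I.n < I.n := Nat.mod_lt _ hn
  refine Eq.trans ?_ (adjEntry_val I.G ⟨p / I.n, h1⟩ ⟨p % I.n, h2⟩).symm
  rw [Nat.add_comm]
  simp only [Inst.encode, List.getD_cons_succ]
  rw [List.getD_eq_getElem _ _ (by simpa using hp), List.getElem_ofFn]
  rfl

theorem Inst.holdsTable_inputState (I : Inst) :
    (inputState I.encode).HoldsTable (adjEntry I.G) I.n := by
  intro x hx y hy
  have hp : x * I.n + y < I.n * I.n := by
    calc x * I.n + y < x * I.n + I.n := by omega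
      _ = (x + 1) * I.n := by ring
      _ ≤ I.n * I.n := Nat.mul_le_mul_right _ hx
  have hn : 0 < I.n := by omega
  have h := I.getD_encode hp
  rw [Nat.add_comm (x * I.n), Nat.add_mul_div_right _ _ hn, Nat.div_eq_of_lt hy, Nat.zero_add,
    Nat.add_mul_mod_self_right, Nat.mod_eq_of_lt hy] at h
  rw [Nat.add_assoc, Nat.add_comm (x * I.n)]
  simpa [inputState] using h

theorem Inst.showsOutput_encode (I : Inst) {τ : State} (h : τ.reg 0 = 3 + I.n * I.n)
    (h0 : τ.mem 1 0 = I.n) (h1 : τ.mem 1 1 = I.k) (h2 : τ.mem 1 2 = I.t)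
    (hp : ∀ p < I.n * I.n, τ.mem 1 (3 + p) = adjEntry I.G (p / I.n) (p % I.n)) :
    ShowsOutput τ I.encode := by
  refine ⟨by rw [h, I.length_encode], fun i hi => ?_⟩
  rw [I.length_encode] at hi
  match i, hi with
  | 0, _ => exact h0
  | 1, _ => exact h1
  | 2, _ => exact h2
  | p + 3, hi =>
    rw [Nat.add_comm p 3, I.getD_encode (by omega), hp p (by omega)]

theorem length_le_bitSize (w : List ℕ) : w.length ≤ bitSize w := by
  induction w with
  | nil => simp
  | cons a w ih =>
    simp only [bitSize, List.length_cons, List.map_cons, List.sum_cons] at ih ⊢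
    omega

theorem bitSize_le (w : List ℕ) (b : ℕ) (h : ∀ x ∈ w, x ≤ b) :
    bitSize w ≤ w.length * (b + 1) := by
  rw [bitSize, ← List.length_map (f := fun m : ℕ => m.size + 1), ← smul_eq_mul]
  refine List.sum_le_card_nsmul _ _ fun x hx => ?_
  obtain ⟨m, hm, rfl⟩ := List.mem_map.1 hx
  have h1 : m.size ≤ m := Nat.size_le.2 Nat.lt_two_pow_self
  have := h m hm
  omega

theorem Inst.n_le_bitSize (I : Inst) : I.n ≤ bitSize I.encode := by
  refine le_trans ?_ (length_le_bitSize _)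
  rw [I.length_encode]
  have := Nat.le_mul_self I.n
  omega

theorem Inst.bitSize_encode_le (I : Inst) {b : ℕ} (hn : I.n ≤ b) (hk : I.k ≤ b) (ht : I.t ≤ b)
    (hb : 1 ≤ b) : bitSize I.encode ≤ (3 + b * b) * (b + 1) := by
  have hlen : I.encode.length ≤ 3 + b * b := by
    rw [I.length_encode]
    have := Nat.mul_le_mul hn hn
    omega
  refine (bitSize_le I.encode b fun x hx => ?_).trans (Nat.mul_le_mul_right _ hlen)
  rw [Inst.encode, List.mem_cons, List.mem_cons, List.mem_cons, List.mem_ofFn] at hx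
  rcases hx with rfl | rfl | rfl | ⟨e, rfl⟩
  · exact hn
  · exact hk
  · exact ht
  · split_ifs <;> omega

/-! ### Correctness of the program -/

/-- The instance with one vertex, one cop and parameter `1`. -/
def trivialInst : Inst := ⟨1, ⊥, 1, 1⟩

theorem trivialInst_valid : trivialInst.Valid where
  connected := by
    have : Subsingleton (Fin trivialInst.n) := inferInstanceAs (Subsingleton (Fin 1))
    have : Nonempty (Fin trivialInst.n) := inferInstanceAs (Nonempty (Fin 1))
    exact ⟨SimpleGraph.Preconnected.of_subsingleton⟩
  cover := by
    have : Subsingleton (Fin trivialInst.n) := inferInstanceAs (Subsingleton (Fin 1))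
    simp
  pos := le_rfl

/-- A bound on the running time of the program in the number of vertices. -/
def timeBound (n : ℕ) : ℕ :=
  n * (n * (n * 30 + 26) + 36) + 10 + (n * (n * 20 + 14) + 19) + 27

theorem timeBound_mono {m n : ℕ} (h : m ≤ n) : timeBound m ≤ timeBound n := by
  unfold timeBound
  gcongr

theorem run_kernelProg (I : Inst) : Run kernelProg (inputState I.encode) (timeBound I.n)
    fun τ => ShowsOutput τ (if I.k < I.t then I.reduce else trivialInst).encode := by
  have main : ∀ σ : State, σ.mem = (inputState I.encode).mem → σ.reg 1 = I.n → σ.reg 2 = I.k →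
      σ.reg 3 = I.t → Run (.ite (.sub (.reg 3) (.reg 2)) (.seq selectKept writeKept) writeTrivial)
        -- The three initial loads take 9 units; the test below takes 4 more.
        σ (timeBound I.n - 9)
        fun τ => ShowsOutput τ (if I.k < I.t then I.reduce else trivialInst).encode := by
    intro σ hm h1 h2 h3
    have hA : σ.HoldsTable (adjEntry I.G) I.n := by
      intro x hx y hy
      rw [hm]
      exact I.holdsTable_inputState x hx y hy
    have hlt : (Expr.sub (.reg 3) (.reg 2)).eval σ = I.t - I.k := by
      rw [Expr.eval, Expr.eval, Expr.eval, h2, h3]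
    refine Run.mono (Run.ite (B := timeBound I.n - 13) (fun h => ?_) fun h => ?_) ?_ fun _ h => h
    · rw [hlt] at h
      rw [if_pos (by omega)]
      have hm : keptCount I.G I.t * (keptCount I.G I.t * 20 + 14) + 19 ≤
          I.n * (I.n * 20 + 14) + 19 := by
        have := keptCount_le_self I.G I.t
        gcongr
      refine (Run.seq (C := I.n * (I.n * 20 + 14) + 19) ((run_selectKept hA h1 h3).mono le_rfl
        fun υ ⟨g0, gr, g4, gk⟩ => ?_)).mono ?_ fun _ h => h
      · have hA' : υ.HoldsTable (adjEntry I.G) I.n := by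
          intro x hx y hy
          rw [g0]
          exact hA x hx y hy
        refine (run_writeKept (K := Nat.nth (Kept (adjEntry I.G) I.n I.t)) hA' g4
          (fun i hi => Nat.nth_lt_of_lt_count hi) (fun i hi => (gk i hi).1)
          fun i hi => (gk i hi).2).mono hm fun τ ⟨o, o0, o1, o2, op⟩ => ?_
        refine I.reduce.showsOutput_encode o o0 ?_ ?_ fun p hp => ?_
        · rw [o1, gr 2 (by norm_num), h2]
          rfl
        · rw [o2, gr 3 (by norm_num), h3]
          rfl
        · have hn : 0 < I.reduce.n := Nat.pos_of_ne_zero fun h => by simp [h] at hp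
          have hx : p / I.reduce.n < I.reduce.n := Nat.div_lt_of_lt_mul hp
          have hy : p % I.reduce.n < I.reduce.n := Nat.mod_lt _ hn
          classical
          refine (op p hp).trans ?_
          refine (adjEntry_val I.G (keptEmb I.G I.t ⟨_, hx⟩) (keptEmb I.G I.t ⟨_, hy⟩)).trans ?_
          exact (adjEntry_val I.reduce.G ⟨_, hx⟩ ⟨_, hy⟩).symm
      · unfold timeBound
        omega
    · rw [hlt] at h
      rw [if_neg (by omega)]
      refine (run_writeTrivial σ).mono ?_ fun τ ⟨o, o0, o1, o2, o3⟩ => ?_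
      · unfold timeBound
        omega
      · refine trivialInst.showsOutput_encode o o0 o1 o2 fun p hp => ?_
        have hp' : p < 1 := hp
        obtain rfl : p = 0 := by omega
        simp [trivialInst, adjEntry, o3]
    · simp only [Expr.cost]
      unfold timeBound
      omega
  refine Run.mono (Run.seq (Run.assign (Run.seq (Run.assign (Run.seq (Run.assign (main _ rfl ?_ ?_
    ?_))))))) ?_ fun _ h => h
  · simp [Expr.eval, inputState, Inst.encode]
  · simp [Expr.eval, inputState, Inst.encode]
  · simp [Expr.eval, inputState, Inst.encode]
  · simp only [Expr.cost]
    unfold timeBound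
    omega

/-! ### Size of the kernel, and the reduction common to the three games -/

/-- A bound on the size of the kernel in terms of the parameter. -/
def sizeBound (t : ℕ) : ℕ :=
  (3 + (t + t * 2 ^ t) * (t + t * 2 ^ t)) * (t + t * 2 ^ t + 1)

theorem computable_sizeBound : Computable sizeBound := by
  -- Powers of two arise by iterated doubling.
  have hpow : Primrec fun t : ℕ => 2 ^ t :=
    (Primrec.nat_iterate (g := fun _ : ℕ => 1) (h := fun _ m : ℕ => 2 * m) Primrec.id
      (Primrec.const 1) (Primrec.nat_mul.comp (Primrec.const 2) Primrec.snd).to₂).of_eq fun t => by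
        simp
  have hB : Primrec fun t : ℕ => t + t * 2 ^ t :=
    Primrec.nat_add.comp Primrec.id (Primrec.nat_mul.comp Primrec.id hpow)
  exact (Primrec.nat_mul.comp
    (Primrec.nat_add.comp (Primrec.const 3) (Primrec.nat_mul.comp hB hB))
    (Primrec.nat_add.comp hB (Primrec.const 1))).to_comp

/-- A problem that `k` cops solve when they can occupy a vertex cover, and that does not change when
false twins are deleted as long as more than `k` of them remain, admits a kernel. -/
theorem admitsKernel_of_keepsTwins (Q : GraphProblem)
    (cover : ∀ (n : ℕ) (G : SimpleGraph (Fin n)) (k : ℕ), G.Connected → 1 ≤ k →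
      G.vertexCoverNum ≤ (k : ℕ∞) → Q n G k)
    (twins : ∀ (n m : ℕ) (G : SimpleGraph (Fin n)) (e : Fin m ↪ Fin n) (k : ℕ),
      Nonempty (Fin m) → KeepsTwins G e k → (Q n G k ↔ Q m (G.comap e) k)) :
    AdmitsKernel Q fun t => t + t * 2 ^ t := by
  refine ⟨kernelProg, .X * (.X * (.X * 30 + 26) + 36) + 10 + (.X * (.X * 20 + 14) + 19) + 27,
    sizeBound, computable_sizeBound, fun I hI => ?_⟩
  have hB : I.t + 1 ≤ I.t + I.t * 2 ^ I.t := by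
    have := Nat.mul_pos hI.pos (Nat.two_pow_pos I.t)
    omega
  have hpos := hI.pos
  obtain ⟨T, τ, hT, hE, hτ⟩ := run_kernelProg I
  have hT' : T ≤ Polynomial.eval (bitSize I.encode)
      (.X * (.X * (.X * 30 + 26) + 36) + 10 + (.X * (.X * 20 + 14) + 19) + 27) := by
    -- The time bound in `n` is one in the input size, as the encoding has `3 + n * n ≥ n` words.
    refine hT.trans ((timeBound_mono I.n_le_bitSize).trans (le_of_eq ?_))
    simp [timeBound]
  by_cases hk : I.k < I.t
  · rw [if_pos hk] at hτ
    have hn : I.reduce.n ≤ I.t + I.t * 2 ^ I.t := keptCount_le I.G I.t hI.cover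
    refine ⟨I.reduce, hI.reduce, ⟨T, τ, hT', hE, hτ⟩,
      twins _ _ _ _ _ hI.reduce.connected.nonempty (keepsTwins_keptEmb I.G I.t hk), hn, ?_⟩
    refine I.reduce.bitSize_encode_le hn ?_ ?_ (by omega)
    · change I.k ≤ _
      omega
    · change I.t ≤ _
      omega
  · rw [if_neg hk] at hτ
    have hone : 1 ≤ I.t + I.t * 2 ^ I.t := by omega
    refine ⟨trivialInst, trivialInst_valid, ⟨T, τ, hT', hE, hτ⟩, iff_of_true ?_ ?_, hone,
      trivialInst.bitSize_encode_le hone hone hone hone⟩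
    · refine cover _ _ _ hI.connected (by omega) (hI.cover.trans ?_)
      exact_mod_cast not_lt.1 hk
    · exact cover _ _ _ trivialInst_valid.connected le_rfl trivialInst_valid.cover

end CopsKernel

theorem theorem9 :
    CopsKernel.AdmitsKernel CopsKernel.FullyActiveCnR (fun t => t + t * 2 ^ t) ∧
    (∀ s : ℕ, 1 ≤ s →
      CopsKernel.AdmitsKernel (CopsKernel.CopsAndFastRobber s) (fun t => t + t * 2 ^ t)) ∧
    CopsKernel.AdmitsKernel CopsKernel.SurroundingCnR (fun t => t + t * 2 ^ t) := by
  refine ⟨?_, fun s _ => ?_, ?_⟩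
  · exact CopsKernel.admitsKernel_of_keepsTwins _
      (fun _ _ _ hG hk hc => CopsKernel.fullyActive_copsWin_of_cover hG hk hc)
      fun _ _ _ _ _ _ hT => CopsKernel.fullyActive_copsWin_comap_iff hT
  · exact CopsKernel.admitsKernel_of_keepsTwins _
      (fun _ _ _ hG hk hc => CopsKernel.fastRobber_copsWin_of_cover s hG hk hc)
      fun _ _ _ _ _ _ hT => CopsKernel.fastRobber_copsWin_comap_iff s hT
  · exact CopsKernel.admitsKernel_of_keepsTwins _
      (fun _ _ _ hG _ hc => CopsKernel.surrounding_copsWin_of_cover hG hc)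
      fun _ _ _ _ _ _ hT => CopsKernel.surrounding_copsWin_comap_iff hT
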